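/- Let $X$ be a compact length space with more than one point, that is, a compact metric space in which the distance between any two points is the infimum of the lengths of the curves joining them. Let $\rho:\tilde X\to X$ be its universal cover (a covering map with $\tilde X$ simply connected), and suppose that it is $n$-fold for a positive integer $n$ (equivalently $|\pi_1(X)|=n$). Equip $\tilde X$ with the lifted metric $$\tilde d(a,b)=\inf\{\ell(\rho\circ\gamma)\;:\;\gamma \text{ a curve in } \tilde X \text{ from } a \text{ to } b\},$$ where $\ell$ denotes the length of curves in $X$. Then $$\operatorname{diam}(\tilde X,\tilde d)<4\sqrt n\,\operatorname{diam}(X).$$ -/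

import Mathlib

open scoped unitInterval

/-- The length of a curve `c : [0,1] → X` in a (pseudo-)metric space: the supremum of
`∑ d(c(t_i), c(t_{i+1}))` over all finite partitions. -/
noncomputable def curveLength {X : Type*} [PseudoEMetricSpace X] (c : I → X) : ENNReal :=
  eVariationOn c Set.univ

/-- A length space: the distance of any two points is the infimum of the lengths of the
continuous curves joining them. -/
def IsLengthSpace (X : Type*) [MetricSpace X] : Prop :=
  ∀ x y : X, edist x y = ⨅ γ : Path x y, curveLength γ

section LiftedMetric

variable {E X : Type*} [TopologicalSpace E] [PseudoEMetricSpace X]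

/-- The lifted distance of `a, b : E` along `ρ : E → X`: the infimum over all curves `γ` in `E`
from `a` to `b` of the length of `γ`, where the length of `γ` is by definition that of `ρ ∘ γ`. -/
noncomputable def liftedEDist (ρ : E → X) (a b : E) : ENNReal :=
  ⨅ γ : Path a b, curveLength (ρ ∘ γ)

theorem liftedEDist_self (ρ : E → X) (a : E) : liftedEDist ρ a a = 0 := by
  refine le_antisymm (iInf_le_of_le (Path.refl a) (le_of_eq ?_)) bot_le
  refine eVariationOn.constant_on ?_
  rintro _ ⟨s, -, rfl⟩ _ ⟨t, -, rfl⟩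
  simp

theorem liftedEDist_le_swap (ρ : E → X) (a b : E) : liftedEDist ρ a b ≤ liftedEDist ρ b a := by
  refine le_iInf fun γ => iInf_le_of_le γ.symm ?_
  have h : AntitoneOn unitInterval.symm Set.univ := fun s _ t _ hst => by
    simpa using hst
  exact eVariationOn.comp_le_of_antitoneOn (ρ ∘ γ) unitInterval.symm h (Set.mapsTo_univ _ _)

theorem curveLength_comp_trans_le (ρ : E → X) {a b c : E} (γ : Path a b) (γ' : Path b c) :
    curveLength (ρ ∘ (γ.trans γ')) ≤ curveLength (ρ ∘ γ) + curveLength (ρ ∘ γ') := by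
  set m : I := ⟨1 / 2, by norm_num, by norm_num⟩ with hm
  have hu : (Set.univ : Set I) = Set.Iic m ∪ Set.Ici m := Set.Iic_union_Ici.symm
  unfold curveLength
  conv_lhs => rw [hu]
  rw [eVariationOn.union _ isGreatest_Iic isLeast_Ici]
  gcongr
  · have h : Set.EqOn (ρ ∘ (γ.trans γ'))
        ((ρ ∘ γ) ∘ fun t : I => Set.projIcc (0 : ℝ) 1 zero_le_one (2 * (t : ℝ))) (Set.Iic m) := by
      intro t ht
      have ht' : (t : ℝ) ≤ 1 / 2 := ht
      simp only [Function.comp_apply, Path.trans_apply, dif_pos ht']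
      congr 2
      exact (Set.projIcc_of_mem _ _).symm
    rw [eVariationOn.congr h]
    refine eVariationOn.comp_le_of_monotoneOn _ _ (fun s _ t _ hst => ?_) (Set.mapsTo_univ _ _)
    exact Set.monotone_projIcc _ (mul_le_mul_of_nonneg_left hst zero_le_two)
  · have h : Set.EqOn (ρ ∘ (γ.trans γ'))
        ((ρ ∘ γ') ∘ fun t : I => Set.projIcc (0 : ℝ) 1 zero_le_one (2 * (t : ℝ) - 1)) (Set.Ici m) := by
      intro t ht
      have ht' : 1 / 2 ≤ (t : ℝ) := ht
      change ρ ((γ.trans γ') t) = ρ (γ' _)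
      congr 1
      have := Path.extend_trans_of_half_le γ γ' ht'
      rwa [Path.extend_apply _ t.2] at this
    rw [eVariationOn.congr h]
    refine eVariationOn.comp_le_of_monotoneOn _ _ (fun s _ t _ hst => ?_) (Set.mapsTo_univ _ _)
    have hst' : (s : ℝ) ≤ t := hst
    exact Set.monotone_projIcc (zero_le_one' ℝ) (by linarith)

theorem liftedEDist_triangle (ρ : E → X) (a b c : E) :
    liftedEDist ρ a c ≤ liftedEDist ρ a b + liftedEDist ρ b c := by
  unfold liftedEDist
  rw [ENNReal.iInf_add]
  refine le_iInf fun γ => ?_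
  rw [ENNReal.add_iInf]
  exact le_iInf fun γ' => iInf_le_of_le (γ.trans γ') (curveLength_comp_trans_le ρ γ γ')

/-- The lifted metric on the total space of `ρ : E → X`. -/
@[reducible] noncomputable def liftedMetric (ρ : E → X) : PseudoEMetricSpace E where
  edist := liftedEDist ρ
  edist_self := liftedEDist_self ρ
  edist_comm a b := le_antisymm (liftedEDist_le_swap ρ a b) (liftedEDist_le_swap ρ b a)
  edist_triangle := liftedEDist_triangle ρ

/-- The diameter of `E` with respect to the lifted metric, as an extended nonnegative real. -/
noncomputable def liftedDiam (ρ : E → X) : ENNReal :=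
  @Metric.ediam E (liftedMetric ρ) Set.univ

end LiftedMetric

/-! Take `R` slightly above `diam X`. The lifted balls of radius `R` about the `n` points of a fibre
cover `E`; let `D` be the diameter of their nerve graph. Then the lifted diameter is at most `2R(D +
1)`, so it suffices that `(D + 1)² < 4n`; as these are integers, this leaves room for `R > diam X`.

Deck transformations make the graph vertex-transitive (`exists_fiberNerve_iso`), and simple
connectivity of `E` makes integral cocycles on it exact (`triangleCocyclesExact_fiberNerve`).
Exactness excludes long thin cycles: vertices of a sphere joined outside the ball are joined inside
the sphere (`exists_walk_in_sphere`). At the midpoint of a diametral geodesic this makes the sphere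
of radius `j` contain at least `2j + 1` vertices, up to about `D/4`, so balls grow quadratically, by
transitivity everywhere. Packing four disjoint balls gives the bound (`sq_dist_succ_lt`). -/

namespace SimpleGraph

/-! ### Spheres in graphs with exact cocycles -/

variable {V : Type*} {G : SimpleGraph V}

/-- The vanishing of the first integral cohomology of the clique complex of a graph: every
integral cochain on ordered pairs which is closed on triangles (degenerate ones included) is the
coboundary of a function on vertices. -/
def TriangleCocyclesExact (G : SimpleGraph V) : Prop :=
  ∀ c : V → V → ℤ,
    (∀ u v w, (u = v ∨ G.Adj u v) → (v = w ∨ G.Adj v w) → (u = w ∨ G.Adj u w) →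
      c u v + c v w = c u w) →
    ∃ φ : V → ℤ, ∀ u v, G.Adj u v → c u v = φ v - φ u

theorem Walk.apply_eq_of_forall_adj {α : Type*} (f : V → α) (P : V → Prop)
    (h : ∀ u v, G.Adj u v → P u → P v → f u = f v) {x y : V} (w : G.Walk x y)
    (hw : ∀ v ∈ w.support, P v) : f x = f y := by
  induction w with
  | nil => rfl
  | @cons a b c hab w ih =>
    have h1 : P a := hw a (by simp)
    have h2 : P b := hw b (by simp)
    exact (h a b hab h1 h2).trans (ih fun v hv => hw v (by simp [hv]))

theorem Connected.dist_le_succ_of_adj (hG : G.Connected) (q : V) {u v : V} (h : G.Adj u v) :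
    G.dist q v ≤ G.dist q u + 1 := by
  have h1 := hG.dist_triangle (u := q) (v := u) (w := v)
  rw [dist_eq_one_iff_adj.2 h] at h1
  exact h1

theorem Walk.dist_add_dist_of_mem_support (hG : G.Connected) {u v z : V} (w : G.Walk u v)
    (hw : w.length = G.dist u v) (hz : z ∈ w.support) :
    G.dist u z + G.dist z v = G.dist u v := by
  classical
  have h1 := dist_le (w.takeUntil z hz)
  have h2 := dist_le (w.dropUntil z hz)
  have h3 := congrArg Walk.length (w.take_spec hz)
  rw [Walk.length_append] at h3
  have h4 := hG.dist_triangle (u := u) (v := z) (w := v)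
  omega

theorem Connected.exists_geodesic (hG : G.Connected) (u v : V) :
    ∃ w : G.Walk u v, ∀ z ∈ w.support, G.dist u z + G.dist z v = G.dist u v := by
  obtain ⟨w, hw⟩ := hG.exists_walk_length_eq_dist u v
  exact ⟨w, fun z hz => w.dist_add_dist_of_mem_support hG hw hz⟩

theorem Connected.exists_dist_eq (hG : G.Connected) (u v : V) {j : ℕ} (hj : j ≤ G.dist u v) :
    ∃ z, G.dist u z = j ∧ j + G.dist z v = G.dist u v := by
  obtain ⟨w, hw⟩ := hG.exists_walk_length_eq_dist u v
  have h0 := w.dist_add_dist_of_mem_support hG hw (w.getVert_mem_support j)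
  have h1 := dist_le (w.take j)
  have h2 := dist_le (w.drop j)
  rw [Walk.take_length] at h1
  rw [Walk.drop_length] at h2
  refine ⟨w.getVert j, ?_⟩
  omega

/-- In a graph whose triangle cocycles are exact, two vertices of a sphere about `q` which can be
joined outside the ball can be joined within the sphere. -/
theorem TriangleCocyclesExact.exists_walk_in_sphere (hc : G.TriangleCocyclesExact)
    (hG : G.Connected) {q x y : V} {k : ℕ} (hx : G.dist q x = k) (hy : G.dist q y = k)
    (w : G.Walk x y) (hw : ∀ v ∈ w.support, k ≤ G.dist q v) :
    ∃ w' : G.Walk x y, ∀ v ∈ w'.support, G.dist q v = k := by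
  classical
  by_contra hcon
  -- `A` is the connected component of `x` within the sphere.
  obtain ⟨A, hAk, hAx, hAy, hAadj⟩ : ∃ A : V → Prop, (∀ v, A v → G.dist q v = k) ∧ A x ∧ ¬ A y ∧
      ∀ u v, A u → G.Adj u v → G.dist q v = k → A v := by
    refine ⟨fun v => ∃ w' : G.Walk x v, ∀ z ∈ w'.support, G.dist q z = k,
      fun v ⟨w', h⟩ => h v (by simp), ⟨.nil, by simpa using hx⟩, hcon, ?_⟩
    rintro u v ⟨w', h⟩ huv hv
    refine ⟨w'.concat huv, fun z hz => ?_⟩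
    rw [Walk.support_concat, List.mem_append] at hz
    rcases hz with hz | hz
    · exact h z hz
    · rw [List.mem_singleton.1 hz, hv]
  have hd : ∀ u v, G.Adj u v → G.dist q v ≤ G.dist q u + 1 :=
    fun u v h => hG.dist_le_succ_of_adj q h
  generalize hδ : G.dist q = δ at *
  -- The cocycle counts signed crossings from `A` to level `k + 1`. It is closed since the third
  -- vertex of a triangle on such an edge lies on level `k`, hence in `A`, or on level `k + 1`.
  obtain ⟨φ, hφ⟩ := hc
    (fun u v => (if A u ∧ δ v = k + 1 then 1 else 0) - (if A v ∧ δ u = k + 1 then 1 else 0)) (by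
      clear hw hcon hc
      intro u v w huv hvw huw
      rcases huv with rfl | huv
      · simp
      rcases hvw with rfl | hvw
      · simp
      rcases huw with rfl | huw
      · ring
      have d1 := hd _ _ huv
      have d2 := hd _ _ hvw
      have d3 := hd _ _ huw
      have d4 := hd _ _ huv.symm
      have d5 := hd _ _ hvw.symm
      have d6 := hd _ _ huw.symm
      have e1 := hAk u
      have e2 := hAk v
      have e3 := hAk w
      have a1 := fun h => hAadj _ _ h huv
      have a2 := fun h => hAadj _ _ h hvw
      have a3 := fun h => hAadj _ _ h huw
      have a4 := fun h => hAadj _ _ h huv.symm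
      have a5 := fun h => hAadj _ _ h hvw.symm
      have a6 := fun h => hAadj _ _ h huw.symm
      clear hd hAadj hAk
      by_cases A u <;> by_cases A v <;> by_cases A w <;> simp_all <;> split_ifs <;> omega)
  -- The cocycle vanishes on edges inside the ball, so `φ x = φ y`.
  have hin : ∀ z, δ z = k → φ q = φ z := by
    intro z hz
    obtain ⟨g, hg⟩ := hG.exists_geodesic q z
    refine g.apply_eq_of_forall_adj φ (fun v => δ v ≤ k) (fun u v huv hu hv => ?_)
      fun v hv => by have := hg v hv; rw [hδ] at this; omega
    have := hφ u v huv
    rw [if_neg (by omega), if_neg (by omega)] at this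
    omega
  -- Outside the ball the cocycle is minus the coboundary of the indicator of `A`, which forces `φ x
  -- + 1 = φ y`.
  have hout := w.apply_eq_of_forall_adj (fun v => φ v + if A v then 1 else 0)
    (fun v => k ≤ δ v) (fun u v huv hu hv => ?_) hw
  · have h1 := hin x hx
    have h2 := hin y hy
    simp only [if_pos hAx, if_neg hAy] at hout
    omega
  · have h1 := hφ u v huv
    have d1 := hd _ _ huv
    have d2 := hd _ _ huv.symm
    have e1 := hAk u
    have e2 := hAk v
    have a1 := fun h => hAadj _ _ h huv
    have a2 := fun h => hAadj _ _ h huv.symm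
    clear hd hAadj hAk hin hφ hw
    by_cases hu' : A u <;> by_cases hv' : A v <;> simp_all
    · omega
    · rw [if_pos (by omega)] at h1
      omega
    · rw [if_pos (by omega)] at h1
      omega

theorem Walk.dist_lt_card [DecidableEq V] {x y : V} (w : G.Walk x y) (S : Finset V)
    (hw : ∀ v ∈ w.support, v ∈ S) : G.dist x y < S.card := by
  have h1 : w.bypass.support.toFinset ⊆ S := fun v hv =>
    hw v (w.support_bypass_subset_support (List.mem_toFinset.1 hv))
  have h2 := Finset.card_le_card h1
  rw [List.toFinset_card_of_nodup w.bypass_isPath.support_nodup, Walk.length_support] at h2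
  have h3 := dist_le w.bypass
  omega

theorem Iso.dist_eq (f : G ≃g G) (u v : V) : G.dist (f u) (f v) = G.dist u v := by
  have key : ∀ (g : G ≃g G) (a b : V), G.Reachable a b → G.dist (g a) (g b) ≤ G.dist a b := by
    intro g a b h
    obtain ⟨w, hw⟩ := h.exists_walk_length_eq_dist
    rw [← hw]
    simpa using dist_le (w.map g.toHom)
  by_cases h : G.Reachable u v
  · refine le_antisymm (key f u v h) ?_
    simpa using key f.symm (f u) (f v) (f.reachable_iff.2 h)
  · rw [dist_eq_zero_of_not_reachable h,
      dist_eq_zero_of_not_reachable (fun h' => h (f.reachable_iff.1 h'))]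

/-! ### Ball growth and packing -/

section Fintype

variable [Fintype V]

/-- The vertices at distance less than `k` from `u`. -/
noncomputable def distBall (G : SimpleGraph V) (u : V) (k : ℕ) : Finset V :=
  Finset.univ.filter fun v => G.dist u v < k

theorem mem_distBall {u v : V} {k : ℕ} : v ∈ G.distBall u k ↔ G.dist u v < k := by
  simp [distBall]

/-- The balls are open and distances integral: a common vertex would give distance at most `k + l -
2`. -/
theorem Connected.disjoint_distBall (hG : G.Connected) {u v : V} {k l : ℕ}
    (h : k + l ≤ G.dist u v + 1) : Disjoint (G.distBall u k) (G.distBall v l) := by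
  refine Finset.disjoint_left.2 fun z hz hz' => ?_
  rw [mem_distBall] at hz hz'
  have := hG.dist_triangle (u := u) (v := z) (w := v)
  rw [dist_comm (u := z)] at this
  omega

theorem Iso.card_distBall (f : G ≃g G) (u : V) (k : ℕ) :
    (G.distBall (f u) k).card = (G.distBall u k).card := by
  refine (Finset.card_bij (fun v _ => f v) (fun v hv => ?_) (fun a _ b _ h => f.injective h)
    fun b hb => ⟨f.symm b, ?_, by simp⟩).symm
  · rw [mem_distBall] at hv ⊢
    rwa [f.dist_eq]
  · rw [mem_distBall] at hb ⊢
    rwa [← f.dist_eq, f.apply_symm_apply]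

/-- Each walk puts at least `2j + 1` vertices on the sphere of radius `j`, and the first `r` odd
numbers sum to `r ^ 2`. -/
theorem sq_le_card_distBall (q : V) (r : ℕ)
    (h : ∀ j < r, ∃ x y, ∃ w : G.Walk x y, 2 * j ≤ G.dist x y ∧
      ∀ v ∈ w.support, G.dist q v = j) : r ^ 2 ≤ (G.distBall q r).card := by
  classical
  induction r with
  | zero => simp
  | succ r ih =>
    have h1 := ih fun j hj => h j (by omega)
    obtain ⟨x, y, w, hxy, hw⟩ := h r (by omega)
    have h2 := w.dist_lt_card (Finset.univ.filter fun v => G.dist q v = r) (by simpa using hw)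
    have h3 : Disjoint (G.distBall q r) (Finset.univ.filter fun v => G.dist q v = r) := by
      refine Finset.disjoint_left.2 fun z hz hz' => ?_
      rw [mem_distBall] at hz
      have := (Finset.mem_filter.1 hz').2
      omega
    have h4 : G.distBall q r ∪ (Finset.univ.filter fun v => G.dist q v = r) ⊆
        G.distBall q (r + 1) := by
      intro z hz
      rw [Finset.mem_union, mem_distBall, Finset.mem_filter] at hz
      rw [mem_distBall]
      omega
    have h5 := Finset.card_le_card h4
    rw [Finset.card_union_of_disjoint h3] at h5
    nlinarith

/-- Quadratic growth of balls about the midpoint `q` of a long geodesic, provided some vertex `p`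
is as far from `q` as possible. -/
theorem TriangleCocyclesExact.sq_le_card_distBall (hc : G.TriangleCocyclesExact)
    (hG : G.Connected) {p q s t : V} {h : ℕ} (hmax : ∀ u v, G.dist u v ≤ G.dist p q)
    (hs : h ≤ G.dist q s) (ht : h ≤ G.dist q t)
    (hst : G.dist q s + G.dist q t = G.dist s t) {r : ℕ} (hr : 2 * r ≤ h + 3) :
    r ^ 2 ≤ (G.distBall q r).card := by
  refine G.sq_le_card_distBall q r fun j hj => ?_
  obtain ⟨x, hx, hxs⟩ := hG.exists_dist_eq q s (j := j) (by omega)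
  obtain ⟨y, hy, hyt⟩ := hG.exists_dist_eq q t (j := j) (by omega)
  -- Go out to `e`, then to `p`. On the second geodesic, adding the triangle inequalities through
  -- `e` and `p` gives `2 * dist q v ≥ h + dist q p - dist e p ≥ h`, and `2 * j ≤ h + 1`.
  have leg : ∀ z e, G.dist q z = j → h ≤ G.dist q e → j + G.dist z e = G.dist q e →
      ∃ w : G.Walk z p, ∀ v ∈ w.support, j ≤ G.dist q v := by
    intro z e hz he hze
    obtain ⟨w₁, hw₁⟩ := hG.exists_geodesic z e
    obtain ⟨w₂, hw₂⟩ := hG.exists_geodesic e p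
    refine ⟨w₁.append w₂, fun v hv => ?_⟩
    rcases (Walk.mem_support_append_iff _ _).1 hv with hv | hv
    · have h1 := hw₁ v hv
      have h2 := hG.dist_triangle (u := q) (v := v) (w := e)
      omega
    · have h1 := hw₂ v hv
      have h2 := hG.dist_triangle (u := q) (v := v) (w := e)
      have h3 := hG.dist_triangle (u := q) (v := v) (w := p)
      have h4 := hmax e p
      rw [dist_comm (u := v) (v := e)] at h2
      rw [dist_comm (u := q) (v := p)] at h3
      omega
  obtain ⟨w₁, hw₁⟩ := leg x s hx hs hxs
  obtain ⟨w₂, hw₂⟩ := leg y t hy ht hyt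
  obtain ⟨w, hw⟩ := hc.exists_walk_in_sphere hG hx hy (w₁.append w₂.reverse) (by
    intro v hv
    rcases (Walk.mem_support_append_iff _ _).1 hv with hv | hv
    · exact hw₁ v hv
    · exact hw₂ v (by simpa using hv))
  refine ⟨x, y, w, ?_, hw⟩
  have h1 := hG.dist_triangle (u := s) (v := x) (w := t)
  have h2 := hG.dist_triangle (u := x) (v := y) (w := t)
  rw [dist_comm (u := s) (v := x)] at h1
  omega

theorem Connected.add_card_distBall_le (hG : G.Connected) {p q s t : V} {a b c d : ℕ}
    (hqp : a + b ≤ G.dist q p + 1) (hqs : a + c ≤ G.dist q s + 1) (hqt : a + d ≤ G.dist q t + 1)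
    (hps : b + c ≤ G.dist p s + 1) (hpt : b + d ≤ G.dist p t + 1)
    (hst : c + d ≤ G.dist s t + 1) :
    (G.distBall q a).card + (G.distBall p b).card + (G.distBall s c).card + (G.distBall t d).card ≤
      Fintype.card V := by
  classical
  have h1 := hG.disjoint_distBall hqp
  have h2 : Disjoint (G.distBall q a ∪ G.distBall p b) (G.distBall s c) :=
    Finset.disjoint_union_left.2 ⟨hG.disjoint_distBall hqs, hG.disjoint_distBall hps⟩
  have h3 : Disjoint (G.distBall q a ∪ G.distBall p b ∪ G.distBall s c) (G.distBall t d) :=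
    Finset.disjoint_union_left.2 ⟨Finset.disjoint_union_left.2
      ⟨hG.disjoint_distBall hqt, hG.disjoint_distBall hpt⟩, hG.disjoint_distBall hst⟩
  rw [← Finset.card_union_of_disjoint h1, ← Finset.card_union_of_disjoint h2,
    ← Finset.card_union_of_disjoint h3]
  exact Finset.card_le_univ _

/-- A finite connected vertex-transitive graph with exact triangle cocycles has at least
quadratically many vertices in terms of its diameter. -/
theorem TriangleCocyclesExact.sq_dist_succ_lt (hc : G.TriangleCocyclesExact) (hG : G.Connected)
    (htrans : ∀ u v : V, ∃ f : G ≃g G, f u = v) (u v : V) :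
    (G.dist u v + 1) ^ 2 < 4 * Fintype.card V := by
  classical
  have hne : Nonempty (V × V) := ⟨(u, v)⟩
  obtain ⟨⟨p, q⟩, hpq⟩ := Finite.exists_max fun z : V × V => G.dist z.1 z.2
  have hmax : ∀ a b, G.dist a b ≤ G.dist p q := fun a b => hpq (a, b)
  -- Moving the midpoint `m` to `q` makes `q` both an end of one diametral geodesic and the midpoint
  -- of another, from `s` to `t`.
  obtain ⟨m, hm, hm'⟩ := hG.exists_dist_eq p q (j := G.dist p q / 2) (by omega)
  obtain ⟨f, hf⟩ := htrans m q
  obtain ⟨s, t, hqs, hqt, hst⟩ : ∃ s t, G.dist q s = G.dist p q / 2 ∧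
      G.dist p q / 2 + G.dist q t = G.dist p q ∧ G.dist s t = G.dist p q := by
    refine ⟨f p, f q, ?_, ?_, f.dist_eq p q⟩
    · rw [← hm, ← hf, dist_comm, f.dist_eq]
    · have := f.dist_eq m q
      rw [hf] at this
      omega
  have hball : ∀ (z : V) (r : ℕ), 2 * r ≤ G.dist p q / 2 + 3 → r ^ 2 ≤ (G.distBall z r).card := by
    intro z r hr
    obtain ⟨g, rfl⟩ := htrans q z
    rw [g.card_distBall]
    exact hc.sq_le_card_distBall hG hmax hqs.ge (t := t) (by omega) (by omega) hr
  have hps := hG.dist_triangle (u := p) (v := s) (w := q)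
  have hpt := hG.dist_triangle (u := p) (v := t) (w := q)
  rw [dist_comm (u := s) (v := q)] at hps
  rw [dist_comm (u := t) (v := q)] at hpt
  have hcomm := dist_comm (G := G) (u := p) (v := q)
  refine lt_of_le_of_lt (Nat.pow_le_pow_left (Nat.succ_le_succ (hmax u v)) 2) ?_
  set D := G.dist p q with hD
  have hcard : 0 < Fintype.card V := Fintype.card_pos_iff.2 ⟨u⟩
  -- For `D = 0` the unit balls about `p` and `q` coincide, so the packing below fails.
  rcases Nat.eq_zero_or_pos D with h0 | h0
  · rw [h0]
    norm_num
    omega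
  have main : ∀ a b c d : ℕ, 2 * a ≤ D / 2 + 3 → 2 * b ≤ D / 2 + 3 → 2 * c ≤ D / 2 + 3 →
      2 * d ≤ D / 2 + 3 → a + b ≤ D + 1 → a + c ≤ D / 2 + 1 → a + d ≤ (D - D / 2) + 1 →
      b + c ≤ (D - D / 2) + 1 → b + d ≤ D / 2 + 1 → c + d ≤ D + 1 →
      a ^ 2 + b ^ 2 + c ^ 2 + d ^ 2 ≤ Fintype.card V := by
    intro a b c d ha hb hc' hd h1 h2 h3 h4 h5 h6
    have := hG.add_card_distBall_le (p := p) (q := q) (s := s) (t := t) (a := a) (b := b)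
      (c := c) (d := d) (by omega) (by omega) (by omega) (by omega) (by omega) (by omega)
    have e1 := hball q a ha
    have e2 := hball p b hb
    have e3 := hball s c hc'
    have e4 := hball t d hd
    omega
  -- Radii near `D / 4` fill the distances of about `D / 2` around the cycle `q`, `s`, `p`, `t`;
  -- rounding depends on `D % 4`.
  obtain ⟨m, hm⟩ : ∃ m, m = D / 4 := ⟨_, rfl⟩
  have hr : D % 4 < 4 := Nat.mod_lt _ (by norm_num)
  have hdec : D = 4 * m + D % 4 := by omega
  interval_cases hDr : D % 4
  · have := main (m + 1) (m + 1) m m (by omega) (by omega) (by omega) (by omega) (by omega)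
      (by omega) (by omega) (by omega) (by omega) (by omega)
    rw [hdec]; nlinarith
  · have := main (m + 1) (m + 1) m m (by omega) (by omega) (by omega) (by omega) (by omega)
      (by omega) (by omega) (by omega) (by omega) (by omega)
    rw [hdec]; nlinarith
  · have := main (m + 1) (m + 1) (m + 1) (m + 1) (by omega) (by omega) (by omega) (by omega)
      (by omega) (by omega) (by omega) (by omega) (by omega) (by omega)
    rw [hdec]; nlinarith
  · have := main (m + 2) (m + 1) m (m + 1) (by omega) (by omega) (by omega) (by omega)
      (by omega) (by omega) (by omega) (by omega) (by omega) (by omega)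
    rw [hdec]; nlinarith

end Fintype

end SimpleGraph

/-! ### Exactness of cocycles on a nerve -/

/-- The nerve of a finite cover of a simply connected space by connected open sets, subordinate to
which there is a partition of unity, has no first cohomology: a cocycle gives a map to the circle,
whose lift to the line yields the potential. -/
theorem SimpleGraph.triangleCocyclesExact_of_cover {E V : Type*} [TopologicalSpace E]
    [SimplyConnectedSpace E] [LocallyPathConnectedSpace E] [Fintype V] (G : SimpleGraph V)
    (U : V → Set E) (hUo : ∀ v, IsOpen (U v)) (hUc : ∀ v, IsPreconnected (U v))
    (hU : ∀ e, ∃ v, e ∈ U v) (hG : ∀ u v, u ≠ v → (U u ∩ U v).Nonempty → G.Adj u v)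
    (hG' : ∀ u v, G.Adj u v → (U u ∩ U v).Nonempty)
    (f : V → E → ℝ) (hf : ∀ v, Continuous (f v)) (hfU : ∀ v e, f v e ≠ 0 → e ∈ U v)
    (hsum : ∀ e, ∑ v, f v e = 1) : G.TriangleCocyclesExact := by
  intro c hc
  have hadj : ∀ {u v e}, e ∈ U u → e ∈ U v → u = v ∨ G.Adj u v := fun {u v e} hu hv =>
    or_iff_not_imp_left.2 fun h => hG u v h ⟨e, hu, hv⟩
  -- Averaging `c u` gives real functions differing by the integer `c u v` on overlaps, so they glue
  -- modulo 1.
  let S : V → E → ℝ := fun u e => ∑ w, f w e * c u w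
  have hScont : ∀ u, Continuous (S u) := fun u =>
    continuous_finsetSum _ fun w _ => (hf w).mul continuous_const
  have hS : ∀ {u v e}, e ∈ U u → e ∈ U v → S u e - S v e = c u v := by
    intro u v e hu hv
    simp only [S]
    rw [← Finset.sum_sub_distrib, ← one_mul (c u v : ℝ), ← hsum e, Finset.sum_mul]
    refine Finset.sum_congr rfl fun w _ => ?_
    by_cases hw : f w e = 0
    · simp [hw]
    · have hw' := hfU w e hw
      rw [← hc u v w (hadj hu hv) (hadj hv hw') (hadj hu hw')]
      push_cast
      ring
  choose o ho using hU
  let F : E → UnitAddCircle := fun e => (S (o e) e : ℝ)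
  have hF : ∀ {u e}, e ∈ U u → F e = (S u e : ℝ) := by
    intro u e hu
    refine sub_eq_zero.1 ?_
    rw [← AddCircle.coe_sub, AddCircle.coe_eq_zero_iff, hS (ho e) hu]
    exact ⟨c (o e) u, by simp⟩
  have hFc : Continuous F := by
    refine continuous_iff_continuousAt.2 fun e => ?_
    refine ContinuousAt.congr ((AddCircle.continuous_mk' (1 : ℝ)).comp (hScont (o e))).continuousAt
      ?_
    filter_upwards [(hUo (o e)).mem_nhds (ho e)] with e' he'
    exact (hF he').symm
  obtain ⟨e₀⟩ : Nonempty E := inferInstance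
  obtain ⟨L, ⟨-, hL⟩, -⟩ := (AddCircle.isCoveringMap_coe (1 : ℝ)).existsUnique_continuousMap_lifts
    ⟨F, hFc⟩ e₀ (S (o e₀) e₀) rfl
  have hval : ∀ {u e}, e ∈ U u → ∃ n : ℤ, (n : ℝ) = L e - S u e := by
    intro u e hu
    have h1 : ((L e : ℝ) : UnitAddCircle) = (S u e : ℝ) := (congrFun hL e).trans (hF hu)
    rw [← sub_eq_zero, ← AddCircle.coe_sub, AddCircle.coe_eq_zero_iff] at h1
    simpa using h1
  -- A continuous integer-valued function on a preconnected set is constant; these constants form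
  -- the potential.
  have hconst : ∀ u, ∃ n : ℤ, ∀ e ∈ U u, L e - S u e = n := by
    intro u
    by_cases hne : (U u).Nonempty
    · obtain ⟨e, he⟩ := hne
      obtain ⟨n, hn⟩ := hval he
      refine ⟨n, fun e' he' => ?_⟩
      rw [hn]
      have hdisc : IsDiscrete (Set.range ((↑) : ℤ → ℝ)) :=
        ⟨Int.isClosedEmbedding_coe_real.isEmbedding.toHomeomorph.symm.isEmbedding.discreteTopology⟩
      exact (hUc u).constant_of_mapsTo hdisc
        (L.continuous.sub (hScont u)).continuousOn (fun z hz => hval hz) he' he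
    · exact ⟨0, fun e he => (hne ⟨e, he⟩).elim⟩
  choose φ hφ using hconst
  refine ⟨φ, fun u v huv => ?_⟩
  obtain ⟨e, hu, hv⟩ := hG' u v huv
  have h1 := hφ u e hu
  have h2 := hφ v e hv
  have h3 := hS hu hv
  have : (c u v : ℝ) = φ v - φ u := by linarith
  exact_mod_cast this

/-! ### Lifted distance and curve length -/

section CurveLength

variable {E X : Type*} [TopologicalSpace E] [PseudoEMetricSpace X]

theorem liftedEDist_comm (ρ : E → X) (a b : E) : liftedEDist ρ a b = liftedEDist ρ b a :=
  le_antisymm (liftedEDist_le_swap ρ a b) (liftedEDist_le_swap ρ b a)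

theorem liftedEDist_apply_le (ρ : E → X) {a b : E} (γ : Path a b) (t : I) :
    liftedEDist ρ a (γ t) ≤ curveLength (ρ ∘ γ) := by
  let γ' : Path a (γ t) :=
    { toFun := fun s => γ (t * s)
      continuous_toFun := γ.continuous.comp (continuous_const.mul continuous_id)
      source' := by simp
      target' := by simp }
  refine (iInf_le _ γ').trans ?_
  have h : MonotoneOn (fun s : I => t * s) Set.univ := fun s _ s' _ hs =>
    mul_le_mul_right hs t
  exact eVariationOn.comp_le_of_monotoneOn (ρ ∘ γ) (fun s : I => t * s) h (Set.mapsTo_univ _ _)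

theorem edist_apply_le_curveLength {x y : X} (γ : Path x y) (t : I) :
    edist x (γ t) ≤ curveLength γ := by
  have := eVariationOn.edist_le γ (Set.mem_univ 0) (Set.mem_univ t)
  rwa [γ.source] at this

theorem isPreconnected_setOf_liftedEDist_lt (ρ : E → X) (v : E) (R : ENNReal) :
    IsPreconnected {e | liftedEDist ρ v e < R} := by
  by_cases hR : 0 < R
  · refine IsPathConnected.isConnected ⟨v, ?_, fun {e} he => ?_⟩ |>.isPreconnected
    · rwa [Set.mem_ofPred_eq, liftedEDist_self]
    · obtain ⟨γ, hγ⟩ := iInf_lt_iff.1 (Set.mem_ofPred.1 he)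
      exact ⟨γ, fun t => (liftedEDist_apply_le ρ γ t).trans_lt hγ⟩
  · convert isPreconnected_empty
    ext e
    simp [not_lt.1 hR |> le_bot_iff.1]

theorem liftedEDist_map_le (ρ : E → X) (g : C(E, E)) (hg : ρ ∘ g = ρ) (a b : E) :
    liftedEDist ρ (g a) (g b) ≤ liftedEDist ρ a b := by
  refine le_iInf fun γ => (iInf_le _ (γ.map g.continuous)).trans_eq ?_
  rw [Path.map_coe, ← Function.comp_assoc, hg]

end CurveLength

theorem IsLengthSpace.exists_path {X : Type*} [MetricSpace X] (hX : IsLengthSpace X) {x y : X}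
    {R : ENNReal} (h : edist x y < R) : ∃ γ : Path x y, curveLength γ < R := by
  rw [hX] at h
  exact iInf_lt_iff.1 h

theorem IsLengthSpace.locallyPathConnectedSpace {X : Type*} [MetricSpace X]
    (hX : IsLengthSpace X) : LocallyPathConnectedSpace X := by
  refine .of_bases (fun x => Metric.nhds_basis_eball) fun x r hr => ?_
  refine ⟨x, Metric.mem_eball_self hr, fun {y} hy => ?_⟩
  rw [Metric.mem_eball'] at hy
  obtain ⟨γ, hγ⟩ := hX.exists_path hy
  exact ⟨γ, fun t => Metric.mem_eball'.2 ((edist_apply_le_curveLength γ t).trans_lt hγ)⟩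

theorem IsLocalHomeomorph.locallyPathConnectedSpace {E X : Type*} [TopologicalSpace E]
    [TopologicalSpace X] [LocallyPathConnectedSpace X] {ρ : E → X} (hρ : IsLocalHomeomorph ρ) :
    LocallyPathConnectedSpace E := by
  choose φ hφ _ using hρ
  let _ : ChartedSpace X E := ⟨Set.range φ, φ, hφ, fun x => ⟨x, rfl⟩⟩
  exact ChartedSpace.locallyPathConnectedSpace X E

/-! ### Curve lifting and deck transformations -/

section Lifting

variable {E X : Type*} [TopologicalSpace E] [MetricSpace X] {ρ : E → X}

theorem IsLocalHomeomorph.eventually_liftedEDist_lt (hρ : IsLocalHomeomorph ρ)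
    (hX : IsLengthSpace X) (e : E) {ε : ENNReal} (hε : 0 < ε) :
    ∀ᶠ e' in nhds e, liftedEDist ρ e e' < ε := by
  obtain ⟨φ, he, rfl⟩ := hρ e
  obtain ⟨r, hr, hrt⟩ := Metric.nhds_basis_eball.mem_iff.1
    (φ.open_target.mem_nhds (φ.map_source he))
  filter_upwards [φ.open_source.mem_nhds he, (φ.continuousAt he).preimage_mem_nhds
    (Metric.eball_mem_nhds (φ e) (lt_min hr hε))] with e' he' hball
  rw [Set.mem_preimage, Metric.mem_eball'] at hball
  obtain ⟨γ, hγ⟩ := hX.exists_path hball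
  have ht : ∀ t, γ t ∈ φ.target := fun t => hrt (Metric.mem_eball'.2
    ((edist_apply_le_curveLength γ t).trans_lt (hγ.trans_le (min_le_left _ _))))
  let γ' : Path e e' := (γ.map' (f := φ.symm)
    (φ.continuousOn_symm.mono (Set.range_subset_iff.2 ht))).cast
      (φ.left_inv he).symm (φ.left_inv he').symm
  have hγ' : φ ∘ γ' = γ := by
    ext t
    exact φ.right_inv (ht t)
  refine (iInf_le _ γ').trans_lt ?_
  rw [hγ']
  exact hγ.trans_le (min_le_right _ _)

theorem IsLocalHomeomorph.continuous_liftedEDist (hρ : IsLocalHomeomorph ρ)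
    (hX : IsLengthSpace X) (v : E) : Continuous (liftedEDist ρ v) := by
  have key : ∀ (Y : Type _) [PseudoEMetricSpace Y] (v : Y), Continuous (edist v) :=
    fun Y _ v => continuous_const.edist continuous_id
  -- The given topology on `E` is finer than that of the lifted pseudometric, for which distance is
  -- continuous.
  refine continuous_le_dom (le_of_nhds_le_nhds fun e => ?_) (@key E (liftedMetric ρ) v)
  refine (@Metric.nhds_basis_eball E (liftedMetric ρ) e).ge_iff.2 fun ε hε => ?_
  filter_upwards [hρ.eventually_liftedEDist_lt hX e hε] with e' he'
  rw [liftedEDist_comm] at he'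
  exact he'

theorem IsCoveringMap.exists_mem_fiber_liftedEDist_lt (hρ : IsCoveringMap ρ)
    (hX : IsLengthSpace X) (x : X) {R : ENNReal} (hR : ∀ y z : X, edist y z < R) (e : E) :
    ∃ v : ρ ⁻¹' {x}, liftedEDist ρ v e < R := by
  obtain ⟨γ, hγ⟩ := hX.exists_path (hR (ρ e) x)
  obtain ⟨Γ, hΓ, h0⟩ := hρ.exists_path_lifts γ e (by simp)
  let γ' : Path e (Γ 1) := ⟨Γ, h0, rfl⟩
  refine ⟨⟨Γ 1, ?_⟩, ?_⟩
  · exact (congrFun hΓ 1).trans γ.target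
  · rw [liftedEDist_comm]
    refine (iInf_le _ γ').trans_lt ?_
    change curveLength (ρ ∘ Γ) < R
    rw [hΓ]
    exact hγ

/-- Lift `ρ` through itself with `u ↦ v` and with `v ↦ u`; uniqueness of lifts makes these mutually
inverse. -/
theorem IsCoveringMap.exists_deck_equiv [SimplyConnectedSpace E] [LocallyPathConnectedSpace E]
    (hρ : IsCoveringMap ρ) {u v : E} (huv : ρ u = ρ v) :
    ∃ g : E ≃ E, g u = v ∧ (∀ e, ρ (g e) = ρ e) ∧
      ∀ a b, liftedEDist ρ (g a) (g b) = liftedEDist ρ a b := by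
  have key : ∀ u v : E, ρ u = ρ v → ∃ g : C(E, E), g u = v ∧ ρ ∘ g = ρ := fun u v h =>
    (hρ.existsUnique_continuousMap_lifts ⟨ρ, hρ.continuous⟩ u v h.symm).exists
  have hid : ∀ (g : C(E, E)) (u : E), g u = u → ρ ∘ g = ρ → ∀ e, g e = e := by
    intro g u hu hg e
    have := (hρ.existsUnique_continuousMap_lifts ⟨ρ, hρ.continuous⟩ u u rfl).unique
      (y₁ := g) (y₂ := .id E) ⟨hu, hg⟩ ⟨rfl, rfl⟩
    exact congrArg (fun f : C(E, E) => f e) this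
  obtain ⟨g, hgu, hg⟩ := key u v huv
  obtain ⟨g', hgv, hg'⟩ := key v u huv.symm
  have h1 : ∀ e, g' (g e) = e := hid (g'.comp g) u (by simp [hgu, hgv]) (by
    rw [ContinuousMap.coe_comp, ← Function.comp_assoc, hg', hg])
  have h2 : ∀ e, g (g' e) = e := hid (g.comp g') v (by simp [hgu, hgv]) (by
    rw [ContinuousMap.coe_comp, ← Function.comp_assoc, hg, hg'])
  refine ⟨⟨g, g', h1, h2⟩, hgu, fun e => congrFun hg e, fun a b => ?_⟩
  refine le_antisymm (liftedEDist_map_le ρ g hg a b) ?_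
  have := liftedEDist_map_le ρ g' hg' (g a) (g b)
  rwa [h1, h1] at this

end Lifting

/-! ### The nerve over a fibre -/

/-- The nerve of the cover of the total space of `ρ` by the lifted balls of radius `R` about the
points of the fibre over `x`. -/
def fiberNerve {E X : Type*} [TopologicalSpace E] [PseudoEMetricSpace X] (ρ : E → X) (x : X)
    (R : ENNReal) : SimpleGraph (ρ ⁻¹' {x}) where
  Adj u v := u ≠ v ∧ ∃ e, liftedEDist ρ u e < R ∧ liftedEDist ρ v e < R
  symm := ⟨fun _ _ ⟨h, e, hu, hv⟩ => ⟨h.symm, e, hv, hu⟩⟩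
  loopless := ⟨fun _ h => h.1 rfl⟩

section FiberNerve

variable {E X : Type*} [TopologicalSpace E] [MetricSpace X] {ρ : E → X} {x : X} {R : ENNReal}

theorem liftedEDist_le_of_walk {u v : ρ ⁻¹' {x}} (w : (fiberNerve ρ x R).Walk u v) :
    liftedEDist ρ u v ≤ 2 * R * w.length := by
  induction w with
  | nil => simp [liftedEDist_self]
  | @cons a b c hab w ih =>
    have hab' := hab
    obtain ⟨-, e, ha, hb⟩ := hab'
    refine (liftedEDist_triangle ρ a b c).trans ?_
    have h1 : liftedEDist ρ a b ≤ 2 * R := by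
      refine (liftedEDist_triangle ρ a e b).trans ?_
      rw [two_mul, liftedEDist_comm ρ e b]
      exact add_le_add ha.le hb.le
    refine (add_le_add h1 ih).trans_eq ?_
    rw [SimpleGraph.Walk.length_cons]
    push_cast
    ring

/-- Each edge costs `2 * R`; the two end legs cost `R` each, absorbed by the strict bound `dist <
k`. -/
theorem liftedEDist_le_of_dist_fiberNerve_lt (hG : (fiberNerve ρ x R).Connected)
    (hcov : ∀ e, ∃ v : ρ ⁻¹' {x}, liftedEDist ρ v e < R) {k : ℕ}
    (hk : ∀ u v, (fiberNerve ρ x R).dist u v < k) (a b : E) :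
    liftedEDist ρ a b ≤ 2 * R * k := by
  obtain ⟨u, hu⟩ := hcov a
  obtain ⟨v, hv⟩ := hcov b
  obtain ⟨w, hw⟩ := hG.exists_walk_length_eq_dist u v
  calc liftedEDist ρ a b ≤ liftedEDist ρ a u + (liftedEDist ρ u v + liftedEDist ρ v b) :=
        (liftedEDist_triangle ρ a u b).trans
          (add_le_add le_rfl (liftedEDist_triangle ρ u v b))
    _ ≤ R + (2 * R * w.length + R) := by
        rw [liftedEDist_comm ρ a u]
        exact add_le_add hu.le (add_le_add (liftedEDist_le_of_walk w) hv.le)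
    _ = 2 * R * (w.length + 1 : ℕ) := by
        push_cast
        ring
    _ ≤ 2 * R * k := by
        gcongr
        rw [hw]
        exact hk u v

theorem fiberNerve_connected [PreconnectedSpace E] [Nonempty E] (hR : 0 < R)
    (hcont : ∀ v, Continuous (liftedEDist ρ v))
    (hcov : ∀ e, ∃ v : ρ ⁻¹' {x}, liftedEDist ρ v e < R) : (fiberNerve ρ x R).Connected := by
  have hopen : ∀ v, IsOpen {e | liftedEDist ρ v e < R} := fun v =>
    isOpen_lt (hcont v) continuous_const
  obtain ⟨e₀⟩ : Nonempty E := inferInstance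
  obtain ⟨v₀, -⟩ := hcov e₀
  refine (SimpleGraph.connected_iff _).2 ⟨fun u v => ?_, ⟨v₀⟩⟩
  -- Balls of different graph components are disjoint, so each component covers a clopen set.
  let W : Set E := ⋃ z ∈ {z : ρ ⁻¹' {x} | (fiberNerve ρ x R).Reachable u z},
    {e | liftedEDist ρ z e < R}
  let W' : Set E := ⋃ z ∈ {z : ρ ⁻¹' {x} | ¬ (fiberNerve ρ x R).Reachable u z},
    {e | liftedEDist ρ z e < R}
  have hdisj : ∀ z e, liftedEDist ρ (z : ρ ⁻¹' {x}) e < R → e ∈ W →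
      (fiberNerve ρ x R).Reachable u z := by
    intro z e hz he
    obtain ⟨z', hz', he'⟩ := Set.mem_iUnion₂.1 he
    by_cases hzz : z' = z
    · exact hzz ▸ hz'
    · have hadj : (fiberNerve ρ x R).Adj z' z := ⟨hzz, e, he', hz⟩
      exact SimpleGraph.Reachable.trans hz' hadj.reachable
  have hcompl : Wᶜ = W' := by
    ext e
    constructor
    · intro he
      obtain ⟨z, hz⟩ := hcov e
      exact Set.mem_iUnion₂.2 ⟨z, fun h => he (Set.mem_iUnion₂.2 ⟨z, h, hz⟩), hz⟩
    · intro he he'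
      obtain ⟨z, hz, hze⟩ := Set.mem_iUnion₂.1 he
      exact hz (hdisj z e hze he')
  have hclopen : IsClopen W := by
    refine ⟨⟨?_⟩, isOpen_biUnion fun z _ => hopen z⟩
    rw [hcompl]
    exact isOpen_biUnion fun z _ => hopen z
  have huniv := hclopen.eq_univ ⟨u, Set.mem_iUnion₂.2
    ⟨u, SimpleGraph.Reachable.refl u, by rwa [Set.mem_ofPred_eq, liftedEDist_self]⟩⟩
  exact hdisj v v (by rwa [liftedEDist_self]) (huniv ▸ Set.mem_univ _)

theorem IsCoveringMap.exists_fiberNerve_iso [SimplyConnectedSpace E]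
    [LocallyPathConnectedSpace E] (hρ : IsCoveringMap ρ) (u v : ρ ⁻¹' {x}) :
    ∃ f : fiberNerve ρ x R ≃g fiberNerve ρ x R, f u = v := by
  obtain ⟨g, hguv, hg, hdist⟩ := hρ.exists_deck_equiv (u.2.trans v.2.symm)
  let f : ρ ⁻¹' {x} ≃ ρ ⁻¹' {x} := g.subtypeEquiv fun a => by
    change ρ a = x ↔ ρ (g a) = x
    rw [hg]
  have hf : ∀ a, ((f a : ρ ⁻¹' {x}) : E) = g a := fun a => rfl
  refine ⟨⟨f, fun {a b} => and_congr f.injective.ne_iff ?_⟩, Subtype.ext hguv⟩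
  rw [← g.exists_congr_right]
  simp only [hf, hdist]

theorem triangleCocyclesExact_fiberNerve [SimplyConnectedSpace E] [LocallyPathConnectedSpace E]
    [Finite (ρ ⁻¹' {x})] (hR : R ≠ ⊤) (hcont : ∀ v, Continuous (liftedEDist ρ v))
    (hcov : ∀ e, ∃ v : ρ ⁻¹' {x}, liftedEDist ρ v e < R) :
    (fiberNerve ρ x R).TriangleCocyclesExact := by
  have := Fintype.ofFinite (ρ ⁻¹' {x})
  -- Truncated subtraction makes `f v` vanish outside the ball; normalising gives the partition of
  -- unity.
  let f : ρ ⁻¹' {x} → E → ℝ := fun v e => (R - liftedEDist ρ v e).toReal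
  have hne : ∀ (v : ρ ⁻¹' {x}) e, R - liftedEDist ρ v e ≠ ⊤ := fun v e =>
    ENNReal.sub_ne_top hR
  have hf : ∀ v, Continuous (f v) := fun v =>
    ENNReal.continuousOn_toReal.comp_continuous
      ((ENNReal.continuous_sub_left hR).comp (hcont v)) (hne v)
  have hf0 : ∀ v e, 0 ≤ f v e := fun v e => ENNReal.toReal_nonneg
  have hpos : ∀ e, 0 < ∑ v, f v e := by
    intro e
    obtain ⟨v, hv⟩ := hcov e
    exact Finset.sum_pos' (fun v _ => hf0 v e) ⟨v, Finset.mem_univ v,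
      ENNReal.toReal_pos (tsub_pos_of_lt hv).ne' (hne v e)⟩
  refine SimpleGraph.triangleCocyclesExact_of_cover _
    (fun v : ρ ⁻¹' {x} => {e | liftedEDist ρ v e < R})
    (fun v => isOpen_lt (hcont v) continuous_const)
    (fun v => isPreconnected_setOf_liftedEDist_lt ρ v R) hcov (fun u v h h' => ⟨h, h'⟩)
    (fun u v h => h.2) (fun v e => f v e / ∑ w, f w e)
    (fun v => (hf v).div (continuous_finsetSum _ fun w _ => hf w) fun e => (hpos e).ne')
    (fun v e h => ?_) fun e => ?_
  · by_contra hcon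
    have hle : R ≤ liftedEDist ρ v e := not_lt.1 fun h' => hcon (Set.mem_ofPred.2 h')
    refine h ?_
    simp [f, tsub_eq_zero_of_le hle]
  · rw [← Finset.sum_div, div_self (hpos e).ne']

end FiberNerve

/-! ### The diameter bound -/

theorem theorem2 {X E : Type*} [MetricSpace X] [CompactSpace X] [Nontrivial X]
    (hX : IsLengthSpace X) [TopologicalSpace E] [SimplyConnectedSpace E] (ρ : E → X)
    (hρ : IsCoveringMap ρ) (n : ℕ) (hn : ∀ x : X, (ρ ⁻¹' {x}).encard = n) :
    liftedDiam ρ < ENNReal.ofReal (4 * √(n : ℝ) * Metric.diam (Set.univ : Set X)) := by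
  have := hX.locallyPathConnectedSpace
  have := hρ.isLocalHomeomorph.locallyPathConnectedSpace
  have hcont := hρ.isLocalHomeomorph.continuous_liftedEDist hX
  obtain ⟨x⟩ : Nonempty X := inferInstance
  have hfin : (ρ ⁻¹' {x}).Finite := Set.finite_of_encard_eq_coe (hn x)
  have := hfin.to_subtype
  have := Fintype.ofFinite (ρ ⁻¹' {x})
  have hcard : Fintype.card (ρ ⁻¹' {x}) = n := by
    have := hn x
    rw [Set.encard_eq_coe_toFinset_card, Set.toFinset_card] at this
    exact_mod_cast this
  have hbdd : Bornology.IsBounded (Set.univ : Set X) := isCompact_univ.isBounded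
  set d := Metric.diam (Set.univ : Set X) with hd
  have hd0 : 0 < d := Metric.diam_pos Set.nontrivial_univ hbdd
  obtain ⟨e₀⟩ : Nonempty E := inferInstance
  have hn1 : 1 ≤ n := by
    rw [← hcard]
    obtain ⟨v, -⟩ :=
      hρ.exists_mem_fiber_liftedEDist_lt hX x (R := ⊤) (fun y z => edist_lt_top y z) e₀
    exact Fintype.card_pos_iff.2 ⟨v⟩
  have hn1' : (1 : ℝ) ≤ n := by exact_mod_cast hn1
  have hs : 0 < √(4 * n - 1 : ℝ) := Real.sqrt_pos.2 (by linarith)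
  have hst : √(4 * n - 1 : ℝ) < 2 * √n := by
    rw [Real.sqrt_lt' (by positivity), mul_pow, Real.sq_sqrt (by positivity)]
    linarith
  -- The upper bound on `R` is exactly `2 * R * √(4 * n - 1) < 4 * √n * d`.
  obtain ⟨R, hdR, hR⟩ : ∃ R, d < R ∧ R < d * (2 * √n) / √(4 * n - 1 : ℝ) := by
    refine exists_between ?_
    rw [lt_div_iff₀ hs]
    exact mul_lt_mul_of_pos_left hst hd0
  rw [lt_div_iff₀ hs] at hR
  have hR0 : 0 < R := hd0.trans hdR
  have hedist : ∀ y z : X, edist y z < ENNReal.ofReal R := fun y z => by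
    rw [edist_dist]
    exact (ENNReal.ofReal_lt_ofReal_iff hR0).2
      ((Metric.dist_le_diam_of_mem hbdd (Set.mem_univ y) (Set.mem_univ z)).trans_lt hdR)
  have hcov := hρ.exists_mem_fiber_liftedEDist_lt hX x hedist
  have hG := fiberNerve_connected (ENNReal.ofReal_pos.2 hR0) hcont hcov
  have hexact := triangleCocyclesExact_fiberNerve ENNReal.ofReal_ne_top hcont hcov
  have hdist : ∀ u v : ρ ⁻¹' {x},
      (((fiberNerve ρ x (ENNReal.ofReal R)).dist u v + 1 : ℕ) : ℝ) ≤ √(4 * n - 1 : ℝ) := by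
    intro u v
    have h := hexact.sq_dist_succ_lt hG hρ.exists_fiberNerve_iso u v
    rw [hcard] at h
    refine Real.le_sqrt_of_sq_le ?_
    have h' : (((fiberNerve ρ x (ENNReal.ofReal R)).dist u v + 1 : ℕ) : ℝ) ^ 2 + 1 ≤ 4 * n := by
      exact_mod_cast h
    linarith
  have hle : liftedDiam ρ ≤ ENNReal.ofReal (2 * R * √(4 * n - 1 : ℝ)) := by
    refine @Metric.ediam_le E _ (liftedMetric ρ) _ fun a _ b _ => ?_
    have hk : ∀ u v, (fiberNerve ρ x (ENNReal.ofReal R)).dist u v < ⌊√(4 * n - 1 : ℝ)⌋₊ :=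
      fun u v => Nat.le_floor (hdist u v)
    refine (liftedEDist_le_of_dist_fiberNerve_lt hG hcov hk a b).trans ?_
    rw [ENNReal.ofReal_mul (by positivity), ENNReal.ofReal_mul (by positivity)]
    gcongr
    · simp
    · rw [← ENNReal.ofReal_natCast]
      exact ENNReal.ofReal_le_ofReal (Nat.floor_le hs.le)
  refine hle.trans_lt ((ENNReal.ofReal_lt_ofReal_iff (by positivity)).2 ?_)
  linarith
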